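/- Let $d\ge 0$ be an integer, let $B^d$ be the open unit ball of Euclidean space $\mathbb R^d$ and $\partial B^d$ its unit sphere. Let $\mathbb R^{d,1}=\mathbb R^d\times\mathbb R$ carry the form $\langle x,y\rangle_{d,1}=\langle\bar x,\bar y\rangle_d-x_{d+1}y_{d+1}$, where $x=(\bar x,x_{d+1})$, let $\mathcal H^d=\{x:\langle x,x\rangle_{d,1}=-1,\ x_{d+1}>0\}$, and let $O_+(d,1)$ be the group of linear isometries of $\mathbb R^{d,1}$ preserving $\mathcal H^d$. It acts on $B^d$ (Klein model) by $A\cdot x=\overline{A(x,1)}\,/\,(A(x,1))_{d+1}$. Put $L(x)=\sqrt{1-\|x\|^2}$. Let $\Gamma$ be a subgroup of $O_+(d,1)$ acting properly discontinuously on $\mathcal H^d$ with compact quotient $\mathcal H^d/\Gamma$ (for example, $\mathcal H^d/\Gamma$ a compact oriented hyperbolic manifold). Let $Z^1(\Gamma,\mathbb R^{d,1})$ be the vector space of cocycles, i.e. of maps $\tau:\Gamma\to\mathbb R^{d,1}$ with $\tau(AB)=\tau(A)+A(\tau(B))$ for all $A,B\in\Gamma$; $\tau$ is a coboundary if there is $v\in\mathbb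 R^{d,1}$ with $\tau(A)=Av-v$ for all $A\in\Gamma$. A continuous map $h:B^d\to\mathbb R$ is called $\tau$-equivariant if for all $A\in\Gamma$ and $x\in B^d$ $$h(x)=\frac{L(x)}{L(A^{-1}\cdot x)}\,h(A^{-1}\cdot x)+\langle x,\overline{\tau(A)}\rangle_d-\tau(A)_{d+1}.$$ Then for every $\tau\in Z^1(\Gamma,\mathbb R^{d,1})$ there exist $\tau$-equivariant maps, and there is a unique continuous map $b_\tau:\partial B^d\to\mathbb R$ such that every $\tau$-equivariant map extends continuously to the closed ball $B^d\cup\partial B^d$ with the values $b_\tau$ on $\partial B^d$. Moreover: 1. $b_{\alpha\tau_1+\tau_2}=\alpha b_{\tau_1}+b_{\tau_2}$ for all $\tau_1,\tau_2\in Z^1(\Gamma,\mathbb R^{d,1})$ and $\alpha\in\mathbb R$; 2. $\tau$ is a coboundary if and only if $b_\tau$ is the restriction to $\partial B^d$ of an affine map $\mathbb R^d\to\mathbb R$. -/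

import Mathlib

namespace CoMinkowski

/-- Minkowski space `ℝ^{d,1}`: pairs of a horizontal component in Euclidean `ℝ^d` and a vertical
component in `ℝ`. -/
abbrev Mink (d : ℕ) : Type := EuclideanSpace ℝ (Fin d) × ℝ

/-- The Lorentzian bilinear form `x₁y₁ + ⋯ + x_d y_d - x_{d+1} y_{d+1}`. -/
noncomputable def form {d : ℕ} (x y : Mink d) : ℝ := inner ℝ x.1 y.1 - x.2 * y.2

/-- The hyperboloid model of hyperbolic `d`-space. -/
def hyperboloid (d : ℕ) : Set (Mink d) := {x | form x x = -1 ∧ 0 < x.2}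

/-- The group `O₊(d,1)` of linear isometries of the Lorentzian form preserving the hyperboloid. -/
def OPlus (d : ℕ) : Subgroup (Mink d ≃ₗ[ℝ] Mink d) where
  carrier := {A | (∀ x y, form (A x) (A y) = form x y) ∧
    ∀ x, A x ∈ hyperboloid d ↔ x ∈ hyperboloid d}
  one_mem' := ⟨fun _ _ => rfl, fun _ => Iff.rfl⟩
  mul_mem' := fun {A B} hA hB =>
    ⟨fun x y => (hA.1 (B x) (B y)).trans (hB.1 x y),
      fun x => (hA.2 (B x)).trans (hB.2 x)⟩
  inv_mem' := fun {A} hA => by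
    have h : ∀ x, A (A⁻¹ x) = x := fun x => A.apply_symm_apply x
    refine ⟨fun x y => ?_, fun x => ?_⟩
    · rw [← hA.1, h, h]
    · rw [← hA.2, h]

/-- The action of `O₊(d,1)` on the hyperboloid. -/
instance (d : ℕ) : MulAction (OPlus d) (hyperboloid d) where
  smul A x := ⟨A.1 x.1, (A.2.2 x.1).2 x.2⟩
  one_smul _ := rfl
  mul_smul _ _ _ := rfl

variable {d : ℕ}

/-- `L(x) = √(1 - ‖x‖²)`. -/
noncomputable def L (x : EuclideanSpace ℝ (Fin d)) : ℝ := Real.sqrt (1 - ‖x‖ ^ 2)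

/-- The action of `A ∈ O₊(d,1)` on the Klein ball: `A • x` is determined by
`(A (x, 1))_{d+1} • (A • x, 1) = A (x, 1)`. -/
noncomputable def klein (A : OPlus d) (x : EuclideanSpace ℝ (Fin d)) :
    EuclideanSpace ℝ (Fin d) :=
  ((A.1 (x, 1)).2)⁻¹ • (A.1 (x, 1)).1

/-- The action of an isometry `(A, v)` of co-Minkowski space on functions on the open unit ball
(the graph of the new function is the image of the graph of `h`). Functions on the ball are
represented by functions on `ℝ^d`, whose values outside the ball play no role. -/
noncomputable def act (A : OPlus d) (v : Mink d) (h : EuclideanSpace ℝ (Fin d) → ℝ)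
    (x : EuclideanSpace ℝ (Fin d)) : ℝ :=
  L x / L (klein A⁻¹ x) * h (klein A⁻¹ x) + inner ℝ x v.1 - v.2

/-- The space `Z¹(Γ, ℝ^{d,1})` of cocycles. -/
def cocycles (Γ : Subgroup (OPlus d)) : Submodule ℝ (Γ → Mink d) where
  carrier := {τ | ∀ A B : Γ, τ (A * B) = τ A + A.1.1 (τ B)}
  zero_mem' := fun A B => by simp
  add_mem' := fun {σ τ} hσ hτ A B => by
    simp only [Pi.add_apply, hσ A B, hτ A B, map_add]
    abel
  smul_mem' := fun c τ hτ A B => by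
    simp only [Pi.smul_apply, hτ A B, map_smul, smul_add]

/-- A cocycle is a coboundary if it is of the form `A ↦ A v - v`. -/
def IsCoboundary {Γ : Subgroup (OPlus d)} (τ : cocycles Γ) : Prop :=
  ∃ v : Mink d, ∀ A : Γ, τ.1 A = A.1.1 v - v

/-- `h` is a `τ`-equivariant map on the open unit ball. -/
def IsEquivariant {Γ : Subgroup (OPlus d)} (τ : cocycles Γ)
    (h : EuclideanSpace ℝ (Fin d) → ℝ) : Prop :=
  ContinuousOn h (Metric.ball 0 1) ∧
    ∀ A : Γ, ∀ x ∈ Metric.ball (0 : EuclideanSpace ℝ (Fin d)) 1, act A.1 (τ.1 A) h x = h x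

/-- The map `h` on the open unit ball extends continuously to the closed ball, with boundary
values `b`. -/
def ExtendsAs (h : EuclideanSpace ℝ (Fin d) → ℝ)
    (b : C(Metric.sphere (0 : EuclideanSpace ℝ (Fin d)) 1, ℝ)) : Prop :=
  ∃ H : EuclideanSpace ℝ (Fin d) → ℝ, ContinuousOn H (Metric.closedBall 0 1) ∧
    (∀ x ∈ Metric.ball (0 : EuclideanSpace ℝ (Fin d)) 1, H x = h x) ∧
    ∀ x : Metric.sphere (0 : EuclideanSpace ℝ (Fin d)) 1, H x = b x

/-- `b` is the restriction to the unit sphere of an affine map on `ℝ^d`. -/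
def IsAffineRestriction (b : C(Metric.sphere (0 : EuclideanSpace ℝ (Fin d)) 1, ℝ)) : Prop :=
  ∃ f : EuclideanSpace ℝ (Fin d) →ᵃ[ℝ] ℝ,
    ∀ x : Metric.sphere (0 : EuclideanSpace ℝ (Fin d)) 1, b x = f x

end CoMinkowski

namespace CoMinkowski

variable {d : ℕ}

/-! Read on the hyperboloid through `toHyp`, equivariance becomes `u X = u (A⁻¹ X) + form X (τ A)`.
Averaging the linear functions `form · (τ A)` with an equivariant partition of unity solves this
(`exists_isEquivariant`).

For boundary values, cocompactness moves every hyperbolic ball of fixed size into one compact set,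
so on it `h` is affine up to `C * L` (`exists_affine_approx`). The affine function varies with the
ball, so dyadic scales along a radius are compared: at depth `s` the error is `O(√s)`, and each
increment is half the previous one up to that error. Since `1/2 < √(1/2)`, the increments are
themselves `O(√s)`, hence summable, uniformly in the direction (`exists_oscillation_bound`). This
gives the continuous extension.

Two equivariant maps for the same `τ` differ by one for the zero cocycle, which is `O(L)` and
vanishes on the sphere; so the boundary values depend only on `τ`, and linearly. A coboundary has an
explicit affine equivariant map. Conversely, if `b τ` is affine, subtracting a coboundary reduces to
zero boundary values, and boundary equivariance then forces the cocycle to vanish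
(`cocycle_eq_zero`). -/

/-! ### The Lorentzian form and the hyperboloid. -/

lemma form_smul_left (a : ℝ) (x y : Mink d) : form (a • x) y = a * form x y := by
  simp only [form, Prod.smul_fst, Prod.smul_snd, inner_smul_left, smul_eq_mul]
  simp
  ring

lemma form_add_right (x y z : Mink d) : form x (y + z) = form x y + form x z := by
  simp only [form, Prod.fst_add, Prod.snd_add, inner_add_right]
  ring

lemma form_smul_right (a : ℝ) (x y : Mink d) : form x (a • y) = a * form x y := by
  simp only [form, Prod.smul_fst, Prod.smul_snd, inner_smul_right, smul_eq_mul]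
  ring

lemma form_sub_right (x y z : Mink d) : form x (y - z) = form x y - form x z := by
  simp only [form, Prod.fst_sub, Prod.snd_sub, inner_sub_right]
  ring

lemma form_self (x : Mink d) : form x x = ‖x.1‖ ^ 2 - x.2 ^ 2 := by
  simp only [form, real_inner_self_eq_norm_sq]
  ring

lemma continuous_form_left (v : Mink d) : Continuous fun x : Mink d => form x v := by
  unfold form
  fun_prop

lemma OPlus.form_apply_left (A : OPlus d) (x y : Mink d) :
    form (A.1 x) y = form x ((A⁻¹).1 y) := by
  rw [← A.2.1 x]
  congr 1
  exact (A.1.apply_symm_apply y).symm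

lemma OPlus.continuous (A : OPlus d) : Continuous fun x : Mink d => A.1 x :=
  A.1.toLinearMap.continuous_of_finiteDimensional

lemma norm_sq_of_mem_hyperboloid {X : Mink d} (hX : X ∈ hyperboloid d) :
    ‖X.1‖ ^ 2 = X.2 ^ 2 - 1 := by
  have := hX.1
  rw [form_self] at this
  linarith

lemma norm_lt_of_mem_hyperboloid {X : Mink d} (hX : X ∈ hyperboloid d) : ‖X.1‖ < X.2 := by
  have h := norm_sq_of_mem_hyperboloid hX
  exact lt_of_pow_lt_pow_left₀ 2 hX.2.le (by linarith)

lemma one_le_of_mem_hyperboloid {X : Mink d} (hX : X ∈ hyperboloid d) : 1 ≤ X.2 := by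
  have h := norm_sq_of_mem_hyperboloid hX
  nlinarith [hX.2, sq_nonneg ‖X.1‖]

/-- Sublevel sets of the height function on the hyperboloid are compact. -/
lemma isCompact_hyperboloid_le (c : ℝ) : IsCompact {X : hyperboloid d | X.1.2 ≤ c} := by
  rw [Subtype.isCompact_iff]
  have hE : ((↑) '' {X : hyperboloid d | X.1.2 ≤ c} : Set (Mink d)) =
      {X | ‖X.1‖ ^ 2 - X.2 ^ 2 = -1 ∧ 1 ≤ X.2 ∧ X.2 ≤ c} := by
    ext X
    constructor
    · rintro ⟨Y, hY, rfl⟩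
      exact ⟨by rw [← form_self]; exact Y.2.1, one_le_of_mem_hyperboloid Y.2, hY⟩
    · rintro ⟨h1, h2, h3⟩
      exact ⟨⟨X, by rw [← form_self] at h1; exact ⟨h1, by linarith⟩⟩, h3, rfl⟩
  rw [hE]
  refine Metric.isCompact_of_isClosed_isBounded ?_ ?_
  · refine (isClosed_eq (by fun_prop) continuous_const).inter
      ((isClosed_le continuous_const continuous_snd).inter
        (isClosed_le continuous_snd continuous_const))
  · refine (Metric.isBounded_closedBall (x := (0 : Mink d)) (r := c)).subset ?_
    rintro X ⟨h1, h2, h3⟩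
    rw [mem_closedBall_zero_iff, Prod.norm_def]
    refine max_le ?_ ?_
    · exact le_of_sq_le_sq (by nlinarith) (by linarith)
    · rw [Real.norm_eq_abs, abs_of_nonneg (by linarith)]
      exact h3

/-- The height of `Z` is controlled by that of `k` and by the hyperbolic distance. -/
lemma height_le {k Z : Mink d} (hk : k ∈ hyperboloid d) (hZ : Z ∈ hyperboloid d) {c a : ℝ}
    (hc : k.2 ≤ c) (ha : -a ≤ form k Z) : Z.2 ≤ 2 * c * a := by
  have h1 := norm_sq_of_mem_hyperboloid hk
  have h2 := norm_lt_of_mem_hyperboloid hk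
  have h3 := norm_lt_of_mem_hyperboloid hZ
  have h4 : inner ℝ k.1 Z.1 ≤ ‖k.1‖ * Z.2 :=
    (real_inner_le_norm _ _).trans (mul_le_mul_of_nonneg_left h3.le (norm_nonneg _))
  have h5 : (k.2 - ‖k.1‖) * Z.2 ≤ a := by
    unfold form at ha
    linarith
  -- On the hyperboloid `k.2 + ‖k.1‖` and `k.2 - ‖k.1‖` are inverse to each other, and the first is
  -- at most `2 * c`.
  have h6 : (k.2 + ‖k.1‖) * ((k.2 - ‖k.1‖) * Z.2) = Z.2 := by linear_combination (-Z.2) * h1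
  have h7 : 0 ≤ (k.2 - ‖k.1‖) * Z.2 := mul_nonneg (by linarith) hZ.2.le
  calc Z.2 = (k.2 + ‖k.1‖) * ((k.2 - ‖k.1‖) * Z.2) := h6.symm
    _ ≤ (2 * c) * a := mul_le_mul (by linarith) h5 h7 (by linarith [norm_nonneg k.1])

/-! ### The Klein ball as the radial projection of the hyperboloid. -/

lemma L_nonneg (x : EuclideanSpace ℝ (Fin d)) : 0 ≤ L x := Real.sqrt_nonneg _

lemma L_sq {x : EuclideanSpace ℝ (Fin d)} (hx : ‖x‖ ≤ 1) : L x ^ 2 = 1 - ‖x‖ ^ 2 :=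
  Real.sq_sqrt (by nlinarith [norm_nonneg x])

lemma L_pos {x : EuclideanSpace ℝ (Fin d)} (hx : x ∈ Metric.ball 0 1) : 0 < L x := by
  rw [mem_ball_zero_iff] at hx
  exact Real.sqrt_pos.2 (by nlinarith [norm_nonneg x])

lemma continuous_L : Continuous (L : EuclideanSpace ℝ (Fin d) → ℝ) := by
  unfold L
  fun_prop

/-- The point of the hyperboloid on the line through `(x, 1)`. -/
noncomputable def lift (x : EuclideanSpace ℝ (Fin d)) : Mink d := (L x)⁻¹ • (x, (1 : ℝ))

/-- The radial projection of the hyperboloid to the Klein ball. -/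
noncomputable def proj (X : Mink d) : EuclideanSpace ℝ (Fin d) := X.2⁻¹ • X.1

lemma lift_mem {x : EuclideanSpace ℝ (Fin d)} (hx : x ∈ Metric.ball 0 1) :
    lift x ∈ hyperboloid d := by
  have h := L_pos hx
  refine ⟨?_, by simpa [lift] using h⟩
  have h1 := L_sq (mem_ball_zero_iff.1 hx).le
  rw [lift, form_smul_left, form_smul_right, form_self]
  field_simp
  linarith

lemma proj_lift {x : EuclideanSpace ℝ (Fin d)} (hx : x ∈ Metric.ball 0 1) :
    proj (lift x) = x := by
  have h := L_pos hx
  simp [proj, lift, smul_smul, h.ne']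

lemma proj_mem {X : Mink d} (hX : X ∈ hyperboloid d) : proj X ∈ Metric.ball 0 1 := by
  rw [mem_ball_zero_iff, proj, norm_smul, norm_inv, Real.norm_eq_abs, abs_of_pos hX.2,
    inv_mul_lt_one₀ hX.2]
  exact norm_lt_of_mem_hyperboloid hX

lemma L_proj {X : Mink d} (hX : X ∈ hyperboloid d) : L (proj X) = X.2⁻¹ := by
  have h := norm_sq_of_mem_hyperboloid hX
  have h2 := hX.2
  rw [L, proj, norm_smul, norm_inv, Real.norm_eq_abs, abs_of_pos hX.2]
  rw [show 1 - (X.2⁻¹ * ‖X.1‖) ^ 2 = (X.2⁻¹) ^ 2 by rw [mul_pow, h]; field_simp; ring]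
  exact Real.sqrt_sq (by positivity)

lemma lift_proj {X : Mink d} (hX : X ∈ hyperboloid d) : lift (proj X) = X := by
  have h2 := hX.2.ne'
  rw [lift, L_proj hX, inv_inv, proj]
  ext1
  · simp [smul_smul, h2]
  · simp

lemma klein_eq_proj (A : OPlus d) {x : EuclideanSpace ℝ (Fin d)} (hx : x ∈ Metric.ball 0 1) :
    klein A x = proj (A.1 (lift x)) := by
  have h := (L_pos hx).ne'
  rw [lift, map_smul, proj, klein, Prod.smul_fst, Prod.smul_snd, smul_smul, smul_eq_mul,
    mul_inv, inv_inv, mul_right_comm, mul_inv_cancel₀ h, one_mul]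

lemma klein_mem (A : OPlus d) {x : EuclideanSpace ℝ (Fin d)} (hx : x ∈ Metric.ball 0 1) :
    klein A x ∈ Metric.ball 0 1 := by
  rw [klein_eq_proj A hx]
  exact proj_mem ((A.2.2 _).2 (lift_mem hx))

lemma lift_klein (A : OPlus d) {x : EuclideanSpace ℝ (Fin d)} (hx : x ∈ Metric.ball 0 1) :
    lift (klein A x) = A.1 (lift x) := by
  rw [klein_eq_proj A hx, lift_proj ((A.2.2 _).2 (lift_mem hx))]

/-- Replaces the quotient in `act`, which degenerates at the sphere, by an expression continuous up
to the boundary. -/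
lemma L_div_L_klein (A : OPlus d) {x : EuclideanSpace ℝ (Fin d)} (hx : x ∈ Metric.ball 0 1) :
    L x / L (klein A x) = (A.1 (x, 1)).2 := by
  have h := (L_pos hx).ne'
  rw [klein_eq_proj A hx, L_proj ((A.2.2 _).2 (lift_mem hx)), div_inv_eq_mul, lift, map_smul,
    Prod.smul_snd, smul_eq_mul, mul_inv_cancel_left₀ h]

lemma form_lift (x : EuclideanSpace ℝ (Fin d)) (v : Mink d) :
    form (lift x) v = (L x)⁻¹ * (inner ℝ x v.1 - v.2) := by
  rw [lift, form_smul_left, form, one_mul]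

/-- The function on the hyperboloid that corresponds to a function on the Klein ball. -/
noncomputable def toHyp (h : EuclideanSpace ℝ (Fin d) → ℝ) (X : Mink d) : ℝ := X.2 * h (proj X)

lemma toHyp_lift (h : EuclideanSpace ℝ (Fin d) → ℝ) {x : EuclideanSpace ℝ (Fin d)}
    (hx : x ∈ Metric.ball 0 1) : h x = L x * toHyp h (lift x) := by
  have h0 := (L_pos hx).ne'
  rw [toHyp, proj_lift hx, lift, Prod.smul_snd, smul_eq_mul, mul_one, mul_inv_cancel_left₀ h0]

lemma continuous_toHyp {h : EuclideanSpace ℝ (Fin d) → ℝ}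
    (hh : ContinuousOn h (Metric.ball 0 1)) : Continuous fun X : hyperboloid d => toHyp h X := by
  unfold toHyp
  refine (continuous_snd.comp continuous_subtype_val).mul ?_
  refine hh.comp_continuous ?_ fun X => proj_mem X.2
  unfold proj
  exact ((continuous_snd.comp continuous_subtype_val).inv₀ fun X => X.2.2.ne').smul
    (continuous_fst.comp continuous_subtype_val)

/-- Equivariance, read on the hyperboloid. -/
lemma IsEquivariant.toHyp_eq {Γ : Subgroup (OPlus d)} {τ : cocycles Γ}
    {h : EuclideanSpace ℝ (Fin d) → ℝ} (hh : IsEquivariant τ h) (A : Γ) {X : Mink d}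
    (hX : X ∈ hyperboloid d) :
    toHyp h X = toHyp h ((A⁻¹ : Γ).1.1 X) + form X (τ.1 A) := by
  have hx := proj_mem hX
  have h1 := hh.2 A _ hx
  have h2 := toHyp_lift h hx
  have h3 := toHyp_lift h (klein_mem (A.1⁻¹) hx)
  have h4 := (L_pos hx).ne'
  have h5 := (L_pos (klein_mem (A.1⁻¹) hx)).ne'
  rw [lift_klein _ hx, lift_proj hX] at h3
  rw [lift_proj hX] at h2
  have h6 := form_lift (proj X) (τ.1 A)
  rw [lift_proj hX] at h6
  rw [act, h2, h3] at h1
  rw [h6]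
  apply mul_left_cancel₀ h4
  rw [← h1]
  field_simp
  rw [add_sub_assoc]
  rfl

/-- A continuous function on the hyperboloid with the equivariance property yields an equivariant
function on the ball. -/
lemma isEquivariant_of_hyperboloid {Γ : Subgroup (OPlus d)} {τ : cocycles Γ}
    {u : hyperboloid d → ℝ} (hu : Continuous u)
    (hτ : ∀ (A : Γ) (X : hyperboloid d), u X = u (A⁻¹ • X) + form X.1 (τ.1 A)) :
    ∃ h, IsEquivariant τ h := by
  classical
  set h : EuclideanSpace ℝ (Fin d) → ℝ := fun x =>
    if hx : x ∈ Metric.ball 0 1 then L x * u ⟨lift x, lift_mem hx⟩ else 0 with hdef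
  have hval : ∀ {x} (hx : x ∈ Metric.ball 0 1), h x = L x * u ⟨lift x, lift_mem hx⟩ :=
    fun hx => dif_pos hx
  refine ⟨h, ?_, fun A x hx => ?_⟩
  · rw [continuousOn_iff_continuous_domRestrict]
    have : Set.domRestrict (Metric.ball 0 1) h = fun x => L x.1 * u ⟨lift x.1, lift_mem x.2⟩ := by
      ext x
      exact hval x.2
    rw [this]
    refine (continuous_L.comp continuous_subtype_val).mul (hu.comp ?_)
    refine Continuous.subtype_mk ?_ _
    unfold lift
    exact ((continuous_L.comp continuous_subtype_val).inv₀ fun x => (L_pos x.2).ne').smul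
      (continuous_subtype_val.prodMk continuous_const)
  · have h4 := (L_pos hx).ne'
    have hk := klein_mem (A.1⁻¹) hx
    have h5 := (L_pos hk).ne'
    rw [act, hval hx, hval hk, hτ A ⟨lift x, lift_mem hx⟩, form_lift]
    have : (⟨lift (klein (A.1⁻¹) x), lift_mem hk⟩ : hyperboloid d) =
        A⁻¹ • ⟨lift x, lift_mem hx⟩ := Subtype.ext (lift_klein _ hx)
    rw [this]
    field_simp
    ring

/-! ### Cocompactness and existence of equivariant maps. -/

instance (Γ : Subgroup (OPlus d)) : ContinuousConstSMul Γ (hyperboloid d) where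
  continuous_const_smul A :=
    ((OPlus.continuous A.1).comp continuous_subtype_val).subtype_mk _

/-- A cocompact group moves every point below some fixed height. -/
lemma exists_height_bound (Γ : Subgroup (OPlus d))
    (hcomp : CompactSpace (Quotient (MulAction.orbitRel Γ (hyperboloid d)))) :
    ∃ c : ℝ, ∀ X : hyperboloid d, ∃ A : Γ, (A • X).1.2 < c := by
  let π : hyperboloid d → Quotient (MulAction.orbitRel Γ (hyperboloid d)) := Quotient.mk _
  have hopen : ∀ n : ℕ, IsOpen (π '' {X : hyperboloid d | X.1.2 < n}) := fun n =>
    -- The quotient map of a group action is open, so the height sublevels have open images; these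
    -- increase with `n`, and compactness leaves a single one.
    isOpenMap_quotient_mk'_mul _
      (isOpen_lt (continuous_snd.comp continuous_subtype_val) continuous_const)
  obtain ⟨n, hn⟩ := isCompact_univ.elim_directed_cover _ hopen
    (by
      rintro q -
      obtain ⟨X, rfl⟩ := Quotient.exists_rep q
      obtain ⟨n, hn⟩ := exists_nat_gt X.1.2
      exact Set.mem_iUnion.2 ⟨n, X, hn, rfl⟩)
    (directed_of_isDirected_le fun m n hmn => Set.image_mono fun X hX =>
      (lt_of_lt_of_le hX (Nat.cast_le.2 hmn) : X.1.2 < n))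
  refine ⟨n, fun X => ?_⟩
  obtain ⟨Y, hY, hXY⟩ := hn (Set.mem_univ (π X))
  obtain ⟨A, hA⟩ := MulAction.orbitRel_apply.1 (Quotient.exact hXY)
  exact ⟨A, (congrArg (fun Z : hyperboloid d => Z.1.2) hA).trans_lt hY⟩

/-- Equivariant functions exist: average `X ↦ form X (τ A)` with an equivariant partition of
unity. -/
lemma exists_isEquivariant {Γ : Subgroup (OPlus d)}
    (hdisc : ProperlyDiscontinuousSMul Γ (hyperboloid d))
    (hcomp : CompactSpace (Quotient (MulAction.orbitRel Γ (hyperboloid d))))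
    (τ : cocycles Γ) : ∃ h, IsEquivariant τ h := by
  obtain ⟨c, hc⟩ := exists_height_bound Γ hcomp
  -- The weight is nonzero exactly when `A⁻¹ • X` is below height `c`: cocompactness makes some
  -- weight positive at each point, proper discontinuity makes the family locally finite.
  let w : Γ → hyperboloid d → ℝ := fun A X => max 0 (c - (A⁻¹ • X).1.2)
  have hwcont : ∀ A, Continuous (w A) := fun A =>
    continuous_const.max (continuous_const.sub
      ((continuous_snd.comp continuous_subtype_val).comp (continuous_const_smul A⁻¹)))
  have hwnonneg : ∀ A X, 0 ≤ w A X := fun A X => le_max_left _ _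
  have hlf : LocallyFinite fun A => Function.support (w A) := by
    intro X
    refine ⟨{Y | Y.1.2 < X.1.2 + 1},
      (isOpen_lt (continuous_snd.comp continuous_subtype_val) continuous_const).mem_nhds
        (by simp), ?_⟩
    refine (ProperlyDiscontinuousSMul.finite_disjoint_inter_image (Γ := Γ) (T := hyperboloid d)
      (isCompact_hyperboloid_le c) (isCompact_hyperboloid_le (X.1.2 + 1))).subset ?_
    rintro A ⟨Y, hY, hY'⟩
    have h1 : (A⁻¹ • Y).1.2 ≤ c := by
      by_contra! hlt
      exact hY (max_eq_left (by linarith))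
    exact
      ⟨Y, ⟨A⁻¹ • Y, h1, smul_inv_smul A Y⟩, (le_of_lt hY' : Y.1.2 ≤ X.1.2 + 1)⟩
  have hfin : ∀ X, (Function.support fun A => w A X).Finite := fun X => hlf.point_finite X
  have hlf' : LocallyFinite fun A => Function.support fun X => w A X * form X.1 (τ.1 A) :=
    hlf.subset fun A X hX => left_ne_zero_of_mul hX
  have hfin' : ∀ X, (Function.support fun A => w A X * form X.1 (τ.1 A)).Finite :=
    fun X => hlf'.point_finite X
  let W : hyperboloid d → ℝ := fun X => ∑ᶠ A, w A X
  let N : hyperboloid d → ℝ := fun X => ∑ᶠ A, w A X * form X.1 (τ.1 A)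
  have hWcont : Continuous W := continuous_finsum hwcont hlf
  have hNcont : Continuous N := continuous_finsum
    (fun A => (hwcont A).mul ((continuous_form_left _).comp continuous_subtype_val)) hlf'
  have hWpos : ∀ X, 0 < W X := by
    intro X
    obtain ⟨A, hA⟩ := hc X
    refine finsum_pos (fun A => hwnonneg A X) ⟨A⁻¹, ?_⟩ (hfin X)
    simp only [w, inv_inv]
    exact lt_max_of_lt_right (by linarith)
  have hw : ∀ (A B : Γ) X, w (A * B) X = w B (A⁻¹ • X) := by
    intro A B X
    simp only [w, mul_inv_rev, mul_smul]
  have hWinv : ∀ (A : Γ) X, W X = W (A⁻¹ • X) := by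
    intro A X
    simp only [W, ← hw]
    exact (finsum_comp_equiv (Equiv.mulLeft A) (f := fun B => w B X)).symm
  have hN : ∀ (A : Γ) X, N X = N (A⁻¹ • X) + W X * form X.1 (τ.1 A) := by
    intro A X
    -- Left translation of the index, followed by the cocycle identity, splits off a term
    -- independent of `B`.
    have h1 : N X = ∑ᶠ B, w (A * B) X * form X.1 (τ.1 (A * B)) :=
      (finsum_comp_equiv (Equiv.mulLeft A) (f := fun B => w B X * form X.1 (τ.1 B))).symm
    have h2 : ∀ B, w (A * B) X * form X.1 (τ.1 (A * B)) =
        w B (A⁻¹ • X) * form (A⁻¹ • X).1 (τ.1 B) + w B (A⁻¹ • X) * form X.1 (τ.1 A) := by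
      intro B
      have h3 : form (A⁻¹ • X).1 (τ.1 B) = form X.1 (A.1.1 (τ.1 B)) := by
        have := OPlus.form_apply_left (A.1⁻¹) X.1 (τ.1 B)
        rwa [inv_inv] at this
      rw [hw, τ.2 A B, form_add_right, h3]
      ring
    rw [h1, finsum_congr h2, finsum_add_distrib (hfin' _), ← finsum_mul, hWinv A X]
    exact (hfin (A⁻¹ • X)).subset fun B hB => left_ne_zero_of_mul hB
  refine isEquivariant_of_hyperboloid (u := fun X => N X / W X)
    (hNcont.div hWcont fun X => (hWpos X).ne') fun A X => ?_
  have h1 := (hWpos X).ne'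
  rw [hN A X, ← hWinv A X, add_div, mul_div_cancel_left₀ _ h1]

/-! ### Affine approximation and radial oscillation. -/

/-- The values of an equivariant function are, up to an error controlled by `L`, those of an
affine function, uniformly on hyperbolic balls of fixed size. -/
lemma IsEquivariant.exists_affine_approx {Γ : Subgroup (OPlus d)}
    (hcomp : CompactSpace (Quotient (MulAction.orbitRel Γ (hyperboloid d))))
    {τ : cocycles Γ} {h : EuclideanSpace ℝ (Fin d) → ℝ} (hh : IsEquivariant τ h) (a : ℝ) :
    ∃ C : ℝ, 0 ≤ C ∧ ∀ x ∈ Metric.ball (0 : EuclideanSpace ℝ (Fin d)) 1, ∃ A : Γ,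
      ∀ y ∈ Metric.ball (0 : EuclideanSpace ℝ (Fin d)) 1, -a ≤ form (lift x) (lift y) →
        |h y - (inner ℝ y (τ.1 A).1 - (τ.1 A).2)| ≤ C * L y := by
  obtain ⟨c, hc⟩ := exists_height_bound Γ hcomp
  obtain ⟨C, hC⟩ := (isCompact_hyperboloid_le (d := d) (2 * c * a)).exists_bound_of_continuousOn
    (continuous_toHyp hh.1).continuousOn
  refine ⟨max C 0, le_max_right _ _, fun x hx => ?_⟩
  obtain ⟨A, hA⟩ := hc ⟨lift x, lift_mem hx⟩
  -- `A` brings `lift x` below height `c`, hence `lift y` below `2 * c * a`; equivariance is applied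
  -- to `A⁻¹`.
  refine ⟨A⁻¹, fun y hy hxy => ?_⟩
  have hL := L_pos hy
  have h1 := hh.toHyp_eq A⁻¹ (lift_mem hy)
  rw [inv_inv] at h1
  have hZ : A.1.1 (lift y) ∈ hyperboloid d := (A.1.2.2 _).2 (lift_mem hy)
  have hk : A.1.1 (lift x) ∈ hyperboloid d := (A.1.2.2 _).2 (lift_mem hx)
  have h2 : (A.1.1 (lift y)).2 ≤ 2 * c * a :=
    height_le hk hZ (le_of_lt hA) (by rw [A.1.2.1]; exact hxy)
  have h3 : |toHyp h (A.1.1 (lift y))| ≤ C := hC ⟨_, hZ⟩ h2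
  have h4 : h y - (inner ℝ y (τ.1 A⁻¹).1 - (τ.1 A⁻¹).2) = L y * toHyp h (A.1.1 (lift y)) := by
    rw [toHyp_lift h hy, h1, form_lift]
    field_simp
    ring
  rw [h4, abs_mul, abs_of_pos hL, mul_comm]
  exact mul_le_mul_of_nonneg_right (h3.trans (le_max_left _ _)) hL.le

lemma L_smul {ω : EuclideanSpace ℝ (Fin d)} (hω : ‖ω‖ = 1) (t : ℝ) :
    L ((1 - t) • ω) = √(t * (2 - t)) := by
  rw [L, norm_smul, hω, mul_one, Real.norm_eq_abs, sq_abs]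
  congr 1
  ring

lemma smul_mem_ball {ω : EuclideanSpace ℝ (Fin d)} (hω : ‖ω‖ = 1) {t : ℝ} (ht0 : 0 < t)
    (ht1 : t ≤ 1) : (1 - t) • ω ∈ Metric.ball 0 1 := by
  rw [mem_ball_zero_iff, norm_smul, hω, mul_one, Real.norm_eq_abs, abs_of_nonneg (by linarith)]
  linarith

/-- On a radius, points at distances `s` and `t ∈ [s / 4, s]` from the sphere are at bounded
hyperbolic distance. -/
lemma form_lift_radial {ω : EuclideanSpace ℝ (Fin d)} (hω : ‖ω‖ = 1) {s t : ℝ} (hs0 : 0 < s)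
    (hs1 : s ≤ 1) (hst : s / 4 ≤ t) (hts : t ≤ s) :
    -4 ≤ form (lift ((1 - s) • ω)) (lift ((1 - t) • ω)) := by
  have ht0 : 0 < t := by linarith
  have ht1 : t ≤ 1 := by linarith
  have h1 := L_pos (smul_mem_ball hω hs0 hs1)
  have h2 := L_pos (smul_mem_ball hω ht0 ht1)
  rw [form_lift, lift, Prod.smul_fst, Prod.smul_snd, inner_smul_left, inner_smul_right,
    inner_smul_right, real_inner_self_eq_norm_sq, hω]
  -- The product is the root of `s(2 - s) * t(2 - t) ≥ s * (s / 4)`.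
  have h3 : s / 2 ≤ L ((1 - s) • ω) * L ((1 - t) • ω) := by
    rw [L_smul hω s, L_smul hω t, ← Real.sqrt_mul (by nlinarith)]
    apply Real.le_sqrt_of_sq_le
    have h4 : s ≤ s * (2 - s) := by nlinarith
    have h5 : s / 4 ≤ t * (2 - t) := by nlinarith
    nlinarith [mul_le_mul h4 h5 (by linarith) (by linarith)]
  simp only [conj_trivial, smul_eq_mul]
  rw [← sub_nonneg]
  have h6 : (L ((1 - s) • ω))⁻¹ * ((1 - s) * ((L ((1 - t) • ω))⁻¹ * ((1 - t) * 1 ^ 2)) -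
      (L ((1 - t) • ω))⁻¹ * 1) - -4 = (4 * (L ((1 - s) • ω) * L ((1 - t) • ω)) - (s + t - s * t)) /
        (L ((1 - s) • ω) * L ((1 - t) • ω)) := by
    field_simp
    ring
  rw [h6]
  apply div_nonneg _ (mul_pos h1 h2).le
  nlinarith

/-- A function on `(0, 1]` that on each `[s / 4, s]` is affine up to `O(√s)` oscillates by `O(√s)`
on each `(0, s]`. -/
lemma exists_oscillation_bound {C M : ℝ} (hC : 0 ≤ C) (hM : 0 ≤ M) :
    ∃ K : ℝ, ∀ g : ℝ → ℝ,
      (∀ s, 0 < s → s ≤ 1 → ∃ p q : ℝ, ∀ t, s / 4 ≤ t → t ≤ s → |g t - (p + q * t)| ≤ C * √s) →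
      (∀ s, 1 / 4 ≤ s → s ≤ 1 → |g s| ≤ M) →
      ∀ s t, 0 < t → t ≤ s → s ≤ 1 → |g t - g s| ≤ K * √s := by
  -- Here `r = √(1/2)`: being above `1/2` closes the recursion on increments, being below `3/4`
  -- bounds their geometric sum by the factor `4`.
  obtain ⟨r, hr0, hr1, hr⟩ : ∃ r : ℝ, 0 < r ∧ r < 3 / 4 ∧ ∀ s, √(s / 2) = r * √s := by
    refine ⟨√(1 / 2), by positivity, (Real.sqrt_lt' (by norm_num)).2 (by norm_num), fun s => ?_⟩
    rw [← Real.sqrt_mul (by norm_num)]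
    congr 1
    ring
  have hr2 : 1 / 2 < r ^ 2 + 1 / 1000 := by
    have := hr 1
    have h1 : √(1 / 2 : ℝ) ^ 2 = 1 / 2 := Real.sq_sqrt (by norm_num)
    rw [this, Real.sqrt_one] at h1
    nlinarith
  have hr3 : 7 / 10 < r := by nlinarith
  -- `4 * M` covers scales `s ≥ 1/2`, where `√s ≥ 1/2`; `20 * C` ensures `D / 2 + 3 * C ≤ D * r`.
  set D := 20 * C + 4 * M with hD
  refine ⟨4 * (D + 2 * C), fun g hg hgM => ?_⟩
  have key : ∀ n : ℕ, ∀ s, (1 / 2 : ℝ) ^ (n + 1) ≤ s → s ≤ 1 → |g (s / 2) - g s| ≤ D * √s := by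
    intro n
    induction n with
    | zero =>
      intro s hs hs1
      have h1 := hgM s (by norm_num at hs; linarith) hs1
      have h2 := hgM (s / 2) (by norm_num at hs; linarith) (by linarith)
      have h3 : 1 / 2 ≤ √s := Real.le_sqrt_of_sq_le (by norm_num at hs; linarith)
      rw [abs_le] at *
      constructor <;> nlinarith
    | succ n ih =>
      intro s hs hs1
      by_cases hs2 : 1 / 2 ≤ s
      · have h1 := hgM s (by linarith) hs1
        have h2 := hgM (s / 2) (by linarith) (by linarith)
        have h3 : 1 / 2 ≤ √s := Real.le_sqrt_of_sq_le (by linarith)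
        rw [abs_le] at *
        constructor <;> nlinarith
      push Not at hs2
      have hs0 : 0 < s := lt_of_lt_of_le (by positivity) hs
      have h1 := ih (2 * s) (by rw [pow_succ] at hs; linarith) (by linarith)
      -- An affine function changes from `s` to `s / 2` by half its change from `2 * s` to `s`; the
      -- three approximation errors add at most `3 * C * S`.
      obtain ⟨p, q, hpq⟩ := hg (2 * s) (by linarith) (by linarith)
      have e1 := hpq (2 * s) (by linarith) le_rfl
      have e2 := hpq s (by linarith) (by linarith)
      have e3 := hpq (s / 2) (by linarith) (by linarith)
      have h4 := hr (2 * s)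
      rw [mul_div_cancel_left₀ s (by norm_num : (2 : ℝ) ≠ 0)] at h1 h4
      have h5 : 0 ≤ √(2 * s) := Real.sqrt_nonneg _
      rw [h4]
      set S := √(2 * s)
      have h6 : (D + 6 * C) / 2 * S ≤ D * (r * S) := by
        have : (D + 6 * C) / 2 ≤ D * r := by nlinarith
        nlinarith
      rw [abs_le] at *
      constructor <;> nlinarith
  have key' : ∀ s, 0 < s → s ≤ 1 → |g (s / 2) - g s| ≤ D * √s := by
    intro s hs hs1
    obtain ⟨n, hn⟩ := exists_pow_lt_of_lt_one hs (by norm_num : (1 / 2 : ℝ) < 1)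
    exact key n s ((pow_le_pow_of_le_one (by norm_num) (by norm_num) (Nat.le_succ n)).trans hn.le)
      hs1
  have near : ∀ s t, 0 < s → s ≤ 1 → s / 2 ≤ t → t ≤ s →
      |g t - g s| ≤ (D + 2 * C) * √s := by
    intro s t hs hs1 hst hts
    obtain ⟨p, q, hpq⟩ := hg s hs hs1
    have e1 := hpq s (by linarith) le_rfl
    have e2 := hpq t (by linarith) hts
    have e3 := hpq (s / 2) (by linarith) (by linarith)
    have h1 := key' s hs hs1
    -- Writing `t` as a convex combination of `s` and `s / 2` cancels the affine part, whose slope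
    -- `q` is uncontrolled.
    obtain ⟨l, hl0, hl1, rfl⟩ : ∃ l : ℝ, 0 ≤ l ∧ l ≤ 1 ∧ t = s - l * (s / 2) :=
      ⟨(s - t) / (s / 2), div_nonneg (by linarith) (by linarith),
        (div_le_one (by linarith)).2 (by linarith), by field_simp; ring⟩
    have e4 : g (s - l * (s / 2)) - g s =
        (g (s - l * (s / 2)) - (p + q * (s - l * (s / 2)))) - (1 - l) * (g s - (p + q * s))
          - l * (g (s / 2) - (p + q * (s / 2))) + l * (g (s / 2) - g s) := by ring
    rw [e4]
    have a1 : |(1 - l) * (g s - (p + q * s))| ≤ (1 - l) * (C * √s) := by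
      rw [abs_mul, abs_of_nonneg (by linarith)]
      exact mul_le_mul_of_nonneg_left e1 (by linarith)
    have a2 : |l * (g (s / 2) - (p + q * (s / 2)))| ≤ l * (C * √s) := by
      rw [abs_mul, abs_of_nonneg hl0]
      exact mul_le_mul_of_nonneg_left e3 hl0
    have a3 : |l * (g (s / 2) - g s)| ≤ D * √s := by
      rw [abs_mul, abs_of_nonneg hl0]
      exact (mul_le_of_le_one_left (abs_nonneg _) hl1).trans h1
    rw [abs_le] at *
    constructor <;> linarith
  have far : ∀ n : ℕ, ∀ s t, 0 < s → s ≤ 1 → (1 / 2 : ℝ) ^ n * s ≤ t → t ≤ s →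
      |g t - g s| ≤ 4 * (D + 2 * C) * √s := by
    intro n
    induction n with
    | zero =>
      intro s t hs hs1 hst hts
      rw [show t = s by linarith, sub_self, abs_zero]
      positivity
    | succ n ih =>
      intro s t hs hs1 hst hts
      have hE : 0 ≤ (D + 2 * C) * √s := by positivity
      by_cases h2 : s / 2 ≤ t
      · have := near s t hs hs1 h2 hts
        linarith
      · push Not at h2
        have h3 := ih (s / 2) t (by linarith) (by linarith) (by rw [pow_succ] at hst; linarith) h2.le
        have h4 := near s (s / 2) hs hs1 le_rfl (by linarith)
        rw [hr s] at h3
        have h5 : 4 * (D + 2 * C) * (r * √s) ≤ 3 * ((D + 2 * C) * √s) := by nlinarith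
        have h6 := abs_sub_le (g t) (g (s / 2)) (g s)
        linarith
  intro s t ht hts hs1
  have hs : 0 < s := by linarith
  obtain ⟨n, hn⟩ := exists_pow_lt_of_lt_one (div_pos ht hs) (by norm_num : (1 / 2 : ℝ) < 1)
  rw [lt_div_iff₀ hs] at hn
  exact far n s t hs hs1 hn.le hts

/-- The approximating affine functions are affine in the depth along a radius, where `L` is at most
`2 * √s`. The constants do not depend on `ω`, which is what makes the boundary limit locally
uniform. -/
lemma IsEquivariant.exists_radial_bound {Γ : Subgroup (OPlus d)}
    (hcomp : CompactSpace (Quotient (MulAction.orbitRel Γ (hyperboloid d))))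
    {τ : cocycles Γ} {h : EuclideanSpace ℝ (Fin d) → ℝ} (hh : IsEquivariant τ h) :
    ∃ K : ℝ, ∀ ω : EuclideanSpace ℝ (Fin d), ‖ω‖ = 1 → ∀ s t : ℝ, 0 < t → t ≤ s → s ≤ 1 →
      |h ((1 - t) • ω) - h ((1 - s) • ω)| ≤ K * √s := by
  obtain ⟨C, hC0, hC⟩ := hh.exists_affine_approx hcomp 4
  obtain ⟨M, hM⟩ :=
    (isCompact_closedBall (0 : EuclideanSpace ℝ (Fin d)) (3 / 4)).exists_bound_of_continuousOn
      (hh.1.mono (Metric.closedBall_subset_ball (by norm_num)))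
  obtain ⟨K, hK⟩ := exists_oscillation_bound (C := 2 * C) (M := max M 0) (by linarith)
    (le_max_right _ _)
  refine ⟨K, fun ω hω => hK (fun t => h ((1 - t) • ω)) (fun s hs hs1 => ?_) fun s hs hs1 => ?_⟩
  · obtain ⟨A, hA⟩ := hC _ (smul_mem_ball hω hs hs1)
    refine ⟨inner ℝ ω (τ.1 A).1 - (τ.1 A).2, -inner ℝ ω (τ.1 A).1, fun t hst hts => ?_⟩
    have ht0 : 0 < t := by linarith
    have h1 := hA _ (smul_mem_ball hω ht0 (hts.trans hs1)) (form_lift_radial hω hs hs1 hst hts)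
    have h2 : L ((1 - t) • ω) ≤ 2 * √s := by
      rw [L_smul hω t]
      apply Real.sqrt_le_iff.2
      refine ⟨by positivity, ?_⟩
      rw [mul_pow, Real.sq_sqrt hs.le]
      nlinarith
    rw [inner_smul_left, conj_trivial] at h1
    calc _ = |h ((1 - t) • ω) - ((1 - t) * inner ℝ ω (τ.1 A).1 - (τ.1 A).2)| := by
          congr 1
          ring
      _ ≤ C * L ((1 - t) • ω) := h1
      _ ≤ C * (2 * √s) := mul_le_mul_of_nonneg_left h2 hC0
      _ = 2 * C * √s := by ring
  · refine (hM _ ?_).trans (le_max_left _ _)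
    rw [mem_closedBall_zero_iff, norm_smul, hω, mul_one, Real.norm_eq_abs,
      abs_of_nonneg (by linarith)]
    linarith

/-! ### Continuous extension to the closed ball. -/

open Filter Topology in
/-- A function on the ball with uniformly controlled radial oscillation has a limit at each point
of the sphere. -/
lemma exists_tendsto_of_radial_bound {h : EuclideanSpace ℝ (Fin d) → ℝ}
    (hh : ContinuousOn h (Metric.ball 0 1)) {K : ℝ}
    (hK : ∀ ω : EuclideanSpace ℝ (Fin d), ‖ω‖ = 1 → ∀ s t : ℝ, 0 < t → t ≤ s → s ≤ 1 →
      |h ((1 - t) • ω) - h ((1 - s) • ω)| ≤ K * √s)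
    {ω : EuclideanSpace ℝ (Fin d)} (hω : ‖ω‖ = 1) :
    ∃ y, Tendsto h (𝓝[Metric.ball 0 1] ω) (𝓝 y) := by
  have hne : (𝓝[Metric.ball 0 1] ω).NeBot := by
    rw [← mem_closure_iff_nhdsWithin_neBot, closure_ball _ one_ne_zero]
    simp [hω]
  refine cauchy_map_iff_exists_tendsto.1 (Metric.cauchy_iff.2 ⟨inferInstance, fun ε hε => ?_⟩)
  obtain ⟨s, hs0, hs1, hs⟩ : ∃ s : ℝ, 0 < s ∧ s < 1 ∧ K * √s < ε / 4 := by
    have h1 : Tendsto (fun s : ℝ => K * √s) (𝓝[>] 0) (𝓝 0) := by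
      have : Continuous fun s : ℝ => K * √s := by fun_prop
      simpa using (this.tendsto 0).mono_left nhdsWithin_le_nhds
    have h2 := (h1.eventually (gt_mem_nhds (by positivity : 0 < ε / 4))).and
      (Ioo_mem_nhdsGT (zero_lt_one' ℝ))
    obtain ⟨s, hs, hs0, hs1⟩ := h2.exists
    exact ⟨s, hs0, hs1, hs⟩
  -- Points near `ω` are pushed radially to depth `s`, where `h` is continuous; the radial bound
  -- controls the cost.
  have hcont : ContinuousAt (fun x : EuclideanSpace ℝ (Fin d) => h ((1 - s) • (‖x‖⁻¹ • x))) ω := by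
    have h1 : ContinuousAt (fun x : EuclideanSpace ℝ (Fin d) => (1 - s) • (‖x‖⁻¹ • x)) ω := by
      have h2 : ContinuousAt (fun x : EuclideanSpace ℝ (Fin d) => ‖x‖⁻¹) ω :=
        continuous_norm.continuousAt.inv₀ (by simp [hω])
      exact (h2.smul continuousAt_id).const_smul (1 - s)
    refine ContinuousAt.comp (g := h) ?_ h1
    apply hh.continuousAt
    rw [hω, inv_one, one_smul]
    exact Metric.isOpen_ball.mem_nhds (smul_mem_ball hω hs0 hs1.le)
  have hev : ∀ᶠ x in 𝓝[Metric.ball 0 1] ω, |h x - h ((1 - s) • ω)| < ε / 2 := by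
    have h1 : ∀ᶠ x in 𝓝 ω, |h ((1 - s) • (‖x‖⁻¹ • x)) - h ((1 - s) • ω)| < ε / 4 := by
      have := Metric.tendsto_nhds.1 hcont (ε / 4) (by positivity)
      simpa only [hω, inv_one, one_smul, Real.dist_eq] using this
    have h2 : ∀ᶠ x in 𝓝 ω, 1 - s < ‖x‖ :=
      continuous_norm.continuousAt.eventually (lt_mem_nhds (by simp only [hω]; linarith))
    filter_upwards [nhdsWithin_le_nhds h1, nhdsWithin_le_nhds h2, self_mem_nhdsWithin]
      with x hx1 hx2 hx3
    rw [mem_ball_zero_iff] at hx3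
    have hx0 : 0 < ‖x‖ := by linarith
    have h3 := hK (‖x‖⁻¹ • x) (by rw [norm_smul, norm_inv, norm_norm, inv_mul_cancel₀ hx0.ne'])
      s (1 - ‖x‖) (by linarith) (by linarith) hs1.le
    rw [sub_sub_cancel, smul_smul ‖x‖, mul_inv_cancel₀ hx0.ne', one_smul] at h3
    have h4 := abs_sub_le (h x) (h ((1 - s) • (‖x‖⁻¹ • x))) (h ((1 - s) • ω))
    linarith
  refine ⟨_, image_mem_map hev, ?_⟩
  rintro _ ⟨x, hx, rfl⟩ _ ⟨y, hy, rfl⟩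
  rw [Set.mem_ofPred_eq] at hx hy
  rw [Real.dist_eq]
  rw [abs_lt] at *
  constructor <;> linarith

open Filter Topology in
/-- Equivariant functions extend continuously to the closed ball. -/
lemma IsEquivariant.exists_extendsAs {Γ : Subgroup (OPlus d)}
    (hcomp : CompactSpace (Quotient (MulAction.orbitRel Γ (hyperboloid d))))
    {τ : cocycles Γ} {h : EuclideanSpace ℝ (Fin d) → ℝ} (hh : IsEquivariant τ h) :
    ∃ b, ExtendsAs h b := by
  obtain ⟨K, hK⟩ := hh.exists_radial_bound hcomp
  have hlim : ∀ x ∈ Metric.closedBall (0 : EuclideanSpace ℝ (Fin d)) 1,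
      ∃ y, Tendsto h (𝓝[Metric.ball 0 1] x) (𝓝 y) := by
    intro x hx
    rcases (mem_closedBall_zero_iff.1 hx).lt_or_eq with hlt | heq
    · exact ⟨h x, hh.1 x (mem_ball_zero_iff.2 hlt)⟩
    · exact exists_tendsto_of_radial_bound hh.1 hK heq
  have hcont := continuousOn_extendFrom (closure_ball _ one_ne_zero).ge hlim
  refine ⟨⟨fun x => extendFrom (Metric.ball 0 1) h x.1,
    hcont.comp_continuous continuous_subtype_val fun x => Metric.sphere_subset_closedBall x.2⟩,
    _, hcont, fun x hx => ?_, fun x => rfl⟩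
  exact extendFrom_eq (subset_closure hx) (hh.1 x hx)

/-! ### Uniqueness and linearity of the boundary values. -/

lemma ExtendsAs.unique {h : EuclideanSpace ℝ (Fin d) → ℝ}
    {b c : C(Metric.sphere (0 : EuclideanSpace ℝ (Fin d)) 1, ℝ)} (hb : ExtendsAs h b)
    (hc : ExtendsAs h c) : b = c := by
  obtain ⟨H, hH, hHh, hHb⟩ := hb
  obtain ⟨G, hG, hGh, hGc⟩ := hc
  have heq : Set.EqOn H G (Metric.closedBall 0 1) :=
    Set.EqOn.of_subset_closure (fun x hx => (hHh x hx).trans (hGh x hx).symm) hH hG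
      Metric.ball_subset_closedBall (closure_ball _ one_ne_zero).ge
  ext x
  rw [← hHb, ← hGc, heq (Metric.sphere_subset_closedBall x.2)]

lemma ExtendsAs.smul_add {h k : EuclideanSpace ℝ (Fin d) → ℝ}
    {b c : C(Metric.sphere (0 : EuclideanSpace ℝ (Fin d)) 1, ℝ)} (hb : ExtendsAs h b)
    (hc : ExtendsAs k c) (α : ℝ) : ExtendsAs (fun x => α * h x + k x) (α • b + c) := by
  obtain ⟨H, hH, hHh, hHb⟩ := hb
  obtain ⟨G, hG, hGh, hGc⟩ := hc
  refine ⟨fun x => α * H x + G x, (continuousOn_const.mul hH).add hG, fun x hx => ?_, fun x => ?_⟩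
  · simp only [hHh x hx, hGh x hx]
  · simp only [hHb, hGc, ContinuousMap.add_apply, ContinuousMap.smul_apply, smul_eq_mul]

lemma IsEquivariant.smul_add {Γ : Subgroup (OPlus d)} {σ τ : cocycles Γ}
    {h k : EuclideanSpace ℝ (Fin d) → ℝ} (hh : IsEquivariant σ h) (hk : IsEquivariant τ k)
    (α : ℝ) : IsEquivariant (α • σ + τ) fun x => α * h x + k x := by
  refine ⟨(continuousOn_const.mul hh.1).add hk.1, fun A x hx => ?_⟩
  beta_reduce
  rw [← hh.2 A x hx, ← hk.2 A x hx]
  simp only [act, Submodule.coe_add, Submodule.coe_smul, Pi.add_apply, Pi.smul_apply,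
    Prod.fst_add, Prod.snd_add, Prod.smul_fst, Prod.smul_snd, inner_add_right, inner_smul_right,
    smul_eq_mul]
  ring

/-- Functions that are equivariant for the zero cocycle vanish on the sphere. -/
lemma IsEquivariant.extendsAs_zero {Γ : Subgroup (OPlus d)}
    (hcomp : CompactSpace (Quotient (MulAction.orbitRel Γ (hyperboloid d))))
    {h : EuclideanSpace ℝ (Fin d) → ℝ} (hh : IsEquivariant (0 : cocycles Γ) h) :
    ExtendsAs h 0 := by
  obtain ⟨b, H, hH, hHh, hHb⟩ := hh.exists_extendsAs hcomp
  obtain ⟨C, -, hC⟩ := hh.exists_affine_approx hcomp 1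
  refine ⟨H, hH, hHh, fun x => ?_⟩
  have hle : |H x| ≤ C * L x.1 := by
    have hx : x.1 ∈ closure (Metric.ball (0 : EuclideanSpace ℝ (Fin d)) 1) := by
      rw [closure_ball _ one_ne_zero]
      exact Metric.sphere_subset_closedBall x.2
    refine ContinuousWithinAt.closure_le hx
      ((hH.abs x.1 (Metric.sphere_subset_closedBall x.2)).mono Metric.ball_subset_closedBall)
      (continuous_const.mul continuous_L).continuousWithinAt fun y hy => ?_
    obtain ⟨A, hA⟩ := hC y hy
    have := hA y hy (lift_mem hy).1.ge
    rw [hHh y hy]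
    simpa using this
  have h0 : L x.1 = 0 := by
    rw [L, mem_sphere_zero_iff_norm.1 x.2]
    simp
  rw [h0, mul_zero] at hle
  simpa using abs_nonpos_iff.1 hle

/-! ### Coboundaries and equivariance on the sphere. -/

/-- On the hyperboloid this map is `X ↦ -form X v`, and `form (A⁻¹ X) v = form X (A v)`. -/
lemma affine_isEquivariant {Γ : Subgroup (OPlus d)} {τ : cocycles Γ} {v : Mink d}
    (hv : ∀ A : Γ, τ.1 A = A.1.1 v - v) :
    IsEquivariant τ fun x => v.2 - inner ℝ x v.1 := by
  refine ⟨by fun_prop, fun A x hx => ?_⟩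
  have h4 := (L_pos hx).ne'
  have h5 := (L_pos (klein_mem (A.1⁻¹) hx)).ne'
  have h1 : form (lift (klein (A.1⁻¹) x)) v = form (lift x) (A.1.1 v) := by
    rw [lift_klein _ hx, OPlus.form_apply_left, inv_inv]
  have h2 : form (lift x) (τ.1 A) = form (lift x) (A.1.1 v) - form (lift x) v := by
    rw [hv, form_sub_right]
  rw [← h1, form_lift, form_lift, form_lift] at h2
  field_simp at h2
  rw [act]
  field_simp
  linarith

/-- The vertical component of the image of a vector in the closed future cone. -/
lemma OPlus.snd_apply_pos (A : OPlus d) {x : EuclideanSpace ℝ (Fin d)} (hx : ‖x‖ ≤ 1) :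
    0 < (A.1 (x, 1)).2 := by
  have hcont : Continuous fun y : EuclideanSpace ℝ (Fin d) => (A.1 (y, 1)).2 :=
    continuous_snd.comp ((OPlus.continuous A).comp (by fun_prop))
  have hnonneg : 0 ≤ (A.1 (x, 1)).2 := by
    have hx' : x ∈ closure (Metric.ball (0 : EuclideanSpace ℝ (Fin d)) 1) := by
      rw [closure_ball _ one_ne_zero]
      simpa using hx
    refine ContinuousWithinAt.closure_le hx' continuousWithinAt_const
      hcont.continuousWithinAt fun y hy => ?_
    rw [← L_div_L_klein A hy]
    exact div_nonneg (L_nonneg _) (L_nonneg _)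
  refine lt_of_le_of_ne hnonneg fun h0 => ?_
  have h1 := A.2.1 (x, 1) (x, 1)
  rw [form_self, form_self, ← h0] at h1
  -- A vector of nonpositive square and zero height is zero, contradicting injectivity of `A`.
  have h2 : ‖(A.1 (x, 1)).1‖ = 0 := by
    have : ‖x‖ ^ 2 ≤ 1 := by nlinarith [norm_nonneg x]
    simp only at h1
    nlinarith [norm_nonneg (A.1 (x, 1)).1]
  have h3 : A.1 (x, 1) = 0 := Prod.ext (norm_eq_zero.1 h2) h0.symm
  have h4 := (LinearEquiv.map_eq_zero_iff A.1).1 h3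
  simpa using congrArg Prod.snd h4

lemma klein_mem_sphere (A : OPlus d) {x : EuclideanSpace ℝ (Fin d)} (hx : ‖x‖ = 1) :
    ‖klein A x‖ = 1 := by
  have h1 := OPlus.snd_apply_pos A hx.le
  have h2 := A.2.1 (x, 1) (x, 1)
  rw [form_self, form_self] at h2
  simp only [hx] at h2
  have h3 : ‖(A.1 (x, 1)).1‖ = (A.1 (x, 1)).2 :=
    (sq_eq_sq₀ (norm_nonneg _) h1.le).1 (by linarith)
  rw [klein, norm_smul, h3, norm_inv, Real.norm_eq_abs, abs_of_pos h1, inv_mul_cancel₀ h1.ne']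

lemma klein_mem_closedBall (A : OPlus d) {x : EuclideanSpace ℝ (Fin d)}
    (hx : x ∈ Metric.closedBall 0 1) : klein A x ∈ Metric.closedBall 0 1 := by
  rcases (mem_closedBall_zero_iff.1 hx).lt_or_eq with hlt | heq
  · exact Metric.ball_subset_closedBall (klein_mem A (mem_ball_zero_iff.2 hlt))
  · exact mem_closedBall_zero_iff.2 (klein_mem_sphere A heq).le

lemma continuousOn_klein (A : OPlus d) : ContinuousOn (klein A) (Metric.closedBall 0 1) := by
  have hc : Continuous fun y : EuclideanSpace ℝ (Fin d) => A.1 (y, 1) :=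
    (OPlus.continuous A).comp (by fun_prop)
  unfold klein
  exact ((continuous_snd.comp hc).continuousOn.inv₀ fun x hx =>
    (OPlus.snd_apply_pos A (mem_closedBall_zero_iff.1 hx)).ne').smul (continuous_fst.comp hc).continuousOn

/-- The equivariance of the boundary values. -/
lemma IsEquivariant.boundary_eq {Γ : Subgroup (OPlus d)} {τ : cocycles Γ}
    {h : EuclideanSpace ℝ (Fin d) → ℝ} (hh : IsEquivariant τ h)
    {b : C(Metric.sphere (0 : EuclideanSpace ℝ (Fin d)) 1, ℝ)} (hb : ExtendsAs h b) (A : Γ)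
    (x : Metric.sphere (0 : EuclideanSpace ℝ (Fin d)) 1) :
    b x = ((A.1⁻¹).1 (x.1, 1)).2 *
      b ⟨klein (A.1⁻¹) x.1, mem_sphere_zero_iff_norm.2
        (klein_mem_sphere _ (mem_sphere_zero_iff_norm.1 x.2))⟩ +
      (inner ℝ x.1 (τ.1 A).1 - (τ.1 A).2) := by
  obtain ⟨H, hH, hHh, hHb⟩ := hb
  have hc : Continuous fun y : EuclideanSpace ℝ (Fin d) => ((A.1⁻¹).1 (y, 1)).2 :=
    continuous_snd.comp ((OPlus.continuous (A.1⁻¹)).comp (by fun_prop))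
  have hG : ContinuousOn (fun y => ((A.1⁻¹).1 (y, 1)).2 * H (klein (A.1⁻¹) y) +
      (inner ℝ y (τ.1 A).1 - (τ.1 A).2)) (Metric.closedBall 0 1) := by
    refine (hc.continuousOn.mul (hH.comp (continuousOn_klein _) fun y hy =>
      klein_mem_closedBall _ hy)).add ?_
    fun_prop
  have heq : Set.EqOn H (fun y => ((A.1⁻¹).1 (y, 1)).2 * H (klein (A.1⁻¹) y) +
      (inner ℝ y (τ.1 A).1 - (τ.1 A).2)) (Metric.closedBall 0 1) := by
    refine Set.EqOn.of_subset_closure (fun y hy => ?_) hH hG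
      Metric.ball_subset_closedBall (closure_ball _ one_ne_zero).ge
    have h1 := hh.2 A y hy
    rw [act, L_div_L_klein _ hy] at h1
    rw [hHh y hy, hHh _ (klein_mem _ hy)]
    linarith
  have h2 := heq (Metric.sphere_subset_closedBall x.2)
  rw [hHb x] at h2
  rw [h2, ← hHb]

/-- A cocycle with vanishing boundary values is trivial. -/
lemma IsEquivariant.cocycle_eq_zero {Γ : Subgroup (OPlus d)} {τ : cocycles Γ}
    {h : EuclideanSpace ℝ (Fin d) → ℝ} (hh : IsEquivariant τ h) (hb : ExtendsAs h 0) (A : Γ) :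
    τ.1 A = 0 := by
  have h1 : ∀ x : EuclideanSpace ℝ (Fin d), ‖x‖ = 1 → inner ℝ x (τ.1 A).1 = (τ.1 A).2 := by
    intro x hx
    have := hh.boundary_eq hb A ⟨x, mem_sphere_zero_iff_norm.2 hx⟩
    simp only [ContinuousMap.zero_apply, mul_zero, zero_add] at this
    linarith
  rcases Nat.eq_zero_or_pos d with rfl | hd
  -- For `d = 0` the sphere is empty and gives no information, but `A` is the identity, where every
  -- cocycle vanishes.
  · have hA : ∀ X : Mink 0, A.1.1 X = X := by
      have h2 : ((0, 1) : Mink 0) ∈ hyperboloid 0 := ⟨by simp [form], by simp⟩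
      have h3 := (A.1.2.2 _).2 h2
      have h4 := norm_sq_of_mem_hyperboloid h3
      have h5 : A.1.1 (0, 1) = ((0, 1) : Mink 0) := by
        refine Prod.ext (Subsingleton.elim _ _) ?_
        rw [Subsingleton.elim (A.1.1 (0, 1)).1 0, norm_zero] at h4
        have h6 := h3.2
        simp only
        nlinarith
      intro X
      have h7 : X = X.2 • ((0, 1) : Mink 0) := Prod.ext (Subsingleton.elim _ _) (by simp)
      rw [h7, map_smul, h5]
    have hA1 : A = 1 := Subtype.ext (Subtype.ext (LinearEquiv.ext hA))
    have h8 := τ.2 A A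
    rw [hA, hA1, mul_one] at h8
    rw [hA1]
    exact left_eq_add.1 h8
  -- Antipodal points give the vertical component opposite values.
  · have h2 : (τ.1 A).2 = 0 := by
      have h3 := h1 (EuclideanSpace.single ⟨0, hd⟩ 1) (by simp)
      have h4 := h1 (-EuclideanSpace.single ⟨0, hd⟩ 1) (by simp)
      rw [inner_neg_left] at h4
      linarith
    refine Prod.ext ?_ h2
    by_contra h0
    have h0' : ‖(τ.1 A).1‖ ≠ 0 := norm_ne_zero_iff.2 h0
    have h3 := h1 (‖(τ.1 A).1‖⁻¹ • (τ.1 A).1)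
      (by rw [norm_smul, norm_inv, norm_norm, inv_mul_cancel₀ h0'])
    rw [h2, inner_smul_left, conj_trivial, real_inner_self_eq_norm_sq] at h3
    simp [h0'] at h3

/-- The coboundary `A ↦ A v - v`. -/
def coboundary (Γ : Subgroup (OPlus d)) (v : Mink d) : cocycles Γ :=
  ⟨fun A => A.1.1 v - v, fun A B => by
    simp only [map_sub]
    change A.1.1 (B.1.1 v) - v = _
    abel⟩

/-- Every affine function on `ℝ^d` is `x ↦ v_{d+1} - ⟨x, v̄⟩` for some `v`. -/
lemma exists_affine_eq (f : EuclideanSpace ℝ (Fin d) →ᵃ[ℝ] ℝ) :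
    ∃ v : Mink d, ∀ x, f x = v.2 - inner ℝ x v.1 := by
  let φ : EuclideanSpace ℝ (Fin d) →L[ℝ] ℝ := LinearMap.toContinuousLinearMap f.linear
  refine ⟨(-(InnerProductSpace.toDual ℝ _).symm φ, f 0), fun x => ?_⟩
  have h1 : inner ℝ x ((InnerProductSpace.toDual ℝ _).symm φ) = f.linear x := by
    rw [real_inner_comm, InnerProductSpace.toDual_symm_apply]
    rfl
  simp only [inner_neg_right, h1]
  have := f.map_vadd 0 x
  simp only [vadd_eq_add, add_zero] at this
  rw [this]
  ring

end CoMinkowski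

/-! ### The main theorem. -/

open CoMinkowski in
theorem mainTheorem7 (d : ℕ) (Γ : Subgroup (OPlus d))
    (hdisc : ProperlyDiscontinuousSMul Γ (hyperboloid d))
    (hcomp : CompactSpace (Quotient (MulAction.orbitRel Γ (hyperboloid d)))) :
    ∃ b : cocycles Γ → C(Metric.sphere (0 : EuclideanSpace ℝ (Fin d)) 1, ℝ),
      (∀ τ, (∃ h, IsEquivariant τ h) ∧ ∀ h, IsEquivariant τ h → ExtendsAs h (b τ)) ∧
      (∀ τ c, (∀ h, IsEquivariant τ h → ExtendsAs h c) → c = b τ) ∧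
      (∀ (τ₁ τ₂ : cocycles Γ) (α : ℝ), b (α • τ₁ + τ₂) = α • b τ₁ + b τ₂) ∧
      ∀ τ, IsCoboundary τ ↔ IsAffineRestriction (b τ) := by
  choose h hh using fun τ : cocycles Γ => exists_isEquivariant hdisc hcomp τ
  choose b hb using fun τ : cocycles Γ => (hh τ).exists_extendsAs hcomp
  have hext : ∀ τ k, IsEquivariant τ k → ExtendsAs k (b τ) := by
    intro τ k hk
    have h1 := (hh τ).smul_add hk (-1)
    rw [show (-1 : ℝ) • τ + τ = 0 by module] at h1
    have h2 := (h1.extendsAs_zero hcomp).smul_add (hb τ) 1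
    simpa using h2
  have hlin : ∀ (τ₁ τ₂ : cocycles Γ) (α : ℝ), b (α • τ₁ + τ₂) = α • b τ₁ + b τ₂ := fun τ₁ τ₂ α =>
    (hext _ _ ((hh τ₁).smul_add (hh τ₂) α)).unique ((hb τ₁).smul_add (hb τ₂) α)
  have haff : ∀ (τ : cocycles Γ) (v : Mink d), (∀ A : Γ, τ.1 A = A.1.1 v - v) →
      ∀ x : Metric.sphere (0 : EuclideanSpace ℝ (Fin d)) 1, b τ x = v.2 - inner ℝ x.1 v.1 := by
    intro τ v hv
    let c : C(Metric.sphere (0 : EuclideanSpace ℝ (Fin d)) 1, ℝ) :=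
      ⟨fun x => v.2 - inner ℝ x.1 v.1, by fun_prop⟩
    have h1 : b τ = c := (hext τ _ (affine_isEquivariant hv)).unique
      ⟨fun x => v.2 - inner ℝ x v.1, by fun_prop, fun _ _ => rfl, fun _ => rfl⟩
    intro x
    rw [h1]
    rfl
  refine ⟨b, fun τ => ⟨⟨h τ, hh τ⟩, hext τ⟩, fun τ c hc => (hc _ (hh τ)).unique (hb τ), hlin,
    fun τ => ⟨?_, ?_⟩⟩
  · rintro ⟨v, hv⟩
    refine ⟨AffineMap.const ℝ _ v.2 - (innerₗ _ v.1).toAffineMap, fun x => ?_⟩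
    rw [haff τ v hv]
    simp [real_inner_comm]
  · rintro ⟨f, hf⟩
    obtain ⟨v, hv⟩ := exists_affine_eq f
    refine ⟨v, fun A => ?_⟩
    -- The coboundary of `v` has the same affine boundary values as `τ`, so their difference falls
    -- under `cocycle_eq_zero`.
    have h1 : b ((-1 : ℝ) • coboundary Γ v + τ) = 0 := by
      ext x
      rw [hlin, ContinuousMap.add_apply, ContinuousMap.smul_apply, hf, hv,
        haff (coboundary Γ v) v fun _ => rfl]
      simp
    have h2 := hb ((-1 : ℝ) • coboundary Γ v + τ)
    rw [h1] at h2
    have h3 := (hh _).cocycle_eq_zero h2 A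
    have h4 : -(A.1.1 v - v) + τ.1 A = 0 := by
      rw [← h3]
      simp [coboundary]
    exact (neg_add_eq_zero.1 h4).symm
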